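/- Let $K,C\ge 0$ be integers. For a real $C\times C$ orthogonal matrix $U\in\mathrm{O}(C)$ and a table $\Lambda=(\lambda_{kj})_{0\le k<K,\,1\le j\le C}$ of positive real gains with rows $\lambda_k=(\lambda_{k1},\dots,\lambda_{kC})\in\mathbb{R}_{>0}^C$, let $$F(U,\Lambda)=\bigl(M(0),\dots,M(K-1)\bigr),\qquad M(k)=U\,\mathrm{diag}(\lambda_k)\,U^{\top},$$ and let $\mathcal{S}^C_{K,+}$ be the set of all tuples $F(U,\Lambda)$ obtained in this way. The joint spectral signature of the eigenmode $j$ is $s_j=(\lambda_{0j},\dots,\lambda_{K-1,j})\in\mathbb{R}_{>0}^K$. Let $\mathcal{G}\subset\mathbb{R}_{>0}^{K\times C}$ be the open set of gain tables with $s_i\neq s_j$ for all $i\neq j$, and let the generic stratum be $\mathcal{S}_{\mathrm{gen}}=F(\mathrm{O}(C)\times\mathcal{G})\subset\mathcal{S}^C_{K,+}$, that is, the set of members of the family whose joint spectral signatures are pairwise distinct (it is nonempty whenever $K\ge 1$). Then $\mathcal{S}_{\mathrm{gen}}$ is a smooth manifold, smoothly embedded in $(\mathbb{R}^{C\times C})^K$,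 of dimension $$\frac{C(C-1)}{2}+KC .$$ The shared-basis parameterization has the same number of local degrees of freedom: $\mathrm{O}(C)$ is a smooth manifold, smoothly embedded in $\mathbb{R}^{C\times C}$, of dimension $C(C-1)/2$, and the gain table, which ranges over an open subset of $\mathbb{R}^{K\times C}$, contributes $KC$. The parameterization matches the stratum locally: $F:\mathrm{O}(C)\times\mathcal{G}\to\mathcal{S}_{\mathrm{gen}}$ is a surjective smooth local diffeomorphism. -/

import Mathlib

open scoped Manifold ContDiff

/-- Real `C × C` matrices, as elements of the normed space `ℝ^{C × C}` of arrays of entries. (Plain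
`Matrix` has no norm in Mathlib, and the smooth structure of a finite-dimensional space does not
depend on the norm.) -/
abbrev MatrixSpace (C : ℕ) : Type := Fin C → Fin C → ℝ

/-- `IsEmbeddedSubmanifold S d`, for a subset `S` of a real normed space `E` that carries an atlas
modelled on `ℝ^d`: with this atlas `S` is a smooth (`C^∞`) manifold of dimension `d`, and the
inclusion `S → E` is a smooth embedding (an immersion that is a homeomorphism onto its image). -/
def IsEmbeddedSubmanifold {E : Type*} [NormedAddCommGroup E] [NormedSpace ℝ E]
    (S : Set E) (d : ℕ) [ChartedSpace (EuclideanSpace ℝ (Fin d)) S] : Prop :=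
  IsManifold (𝓡 d) ∞ S ∧
    Manifold.IsSmoothEmbedding (𝓡 d) 𝓘(ℝ, E) ∞ (Subtype.val : S → E)

/-- The orthogonal group `O(C)`, as a subset of `ℝ^{C × C}`. -/
def orthogonalMatrices (C : ℕ) : Set (MatrixSpace C) :=
  {U | Matrix.of U ∈ Matrix.orthogonalGroup (Fin C) ℝ}

/-- The tables `Λ = (λ_{kj})` of positive gains, an open subset of `ℝ^{K × C}`. -/
def positiveGains (K C : ℕ) : TopologicalSpace.Opens (Fin K → Fin C → ℝ) where
  carrier := {Λ | ∀ k j, 0 < Λ k j}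
  is_open' := by
    simp only [Set.ofPred_forall]
    exact isOpen_iInter_of_finite fun k => isOpen_iInter_of_finite fun j =>
      isOpen_lt continuous_const (by fun_prop)

/-- The joint spectral signature `s_j = (λ_{0j}, …, λ_{K-1,j})` of the eigenmode `j`. -/
def jointSignature {K C : ℕ} (Λ : Fin K → Fin C → ℝ) (j : Fin C) : Fin K → ℝ :=
  fun k => Λ k j

/-- The tables of positive gains whose joint spectral signatures are pairwise distinct,
an open subset of `ℝ^{K × C}`. -/
def genericGains (K C : ℕ) : TopologicalSpace.Opens (Fin K → Fin C → ℝ) where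
  carrier := {Λ | Λ ∈ positiveGains K C ∧
    ∀ i j, i ≠ j → jointSignature Λ i ≠ jointSignature Λ j}
  is_open' := by
    have h : IsOpen {Λ : Fin K → Fin C → ℝ |
        ∀ i j, i ≠ j → jointSignature Λ i ≠ jointSignature Λ j} := by
      simp only [Set.ofPred_forall]
      exact isOpen_iInter_of_finite fun i => isOpen_iInter_of_finite fun j =>
        isOpen_iInter_of_finite fun _ =>
          isOpen_ne_fun (by unfold jointSignature; fun_prop) (by unfold jointSignature; fun_prop)
    exact (positiveGains K C).isOpen.inter h

/-- The direct shared-basis operator: `M(k) = U diag(λ_k) Uᵀ` for `k = 0, …, K-1`. -/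
def sharedBasisOperator {K C : ℕ} (U : MatrixSpace C) (Λ : Fin K → Fin C → ℝ) :
    Fin K → MatrixSpace C :=
  fun k => Matrix.of.symm
    (Matrix.of U * Matrix.diagonal (Λ k) * (Matrix.of U).transpose)

/-- The positive-gain shared-basis family `S^C_{K,+}`. -/
def sharedBasisFamily (K C : ℕ) : Set (Fin K → MatrixSpace C) :=
  {M | ∃ U ∈ orthogonalMatrices C, ∃ Λ ∈ positiveGains K C, M = sharedBasisOperator U Λ}

/-- The generic stratum of the family: its members with pairwise distinct joint spectral
signatures. (Two representations of the same member have the same signatures up to order, so it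
does not matter which one is used.) -/
def genericStratum (K C : ℕ) : Set (Fin K → MatrixSpace C) :=
  {M | M ∈ sharedBasisFamily K C ∧
    ∃ U ∈ orthogonalMatrices C, ∃ Λ ∈ genericGains K C, M = sharedBasisOperator U Λ}

/-- The shared-basis parameterization `(U, Λ) ↦ (M(0), …, M(K-1))` of the generic stratum. -/
def sharedBasisParam (K C : ℕ) (p : orthogonalMatrices C × genericGains K C) :
    genericStratum K C :=
  ⟨sharedBasisOperator p.1.1 p.2.1,
    ⟨p.1.1, p.1.2, p.2.1, p.2.2.1, rfl⟩, p.1.1, p.1.2, p.2.1, p.2.2, rfl⟩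

/-!
The proof has a general half, about subsets of a finite-dimensional space that are straightened by
charts of the ambient space, and a half about the shared-basis family.

*Slice charts.* If around every point of `S` a real-analytic chart of the ambient space maps `S` to
`ℝ^d × {0}`, the first coordinates of these charts make `S` an embedded submanifold of dimension `d`
(`HasSliceCharts.isManifold`, `HasSliceCharts.isSmoothEmbedding`). By the inverse function theorem,
slice charts come from equations with injective derivative (`hasSliceChartAt_of_equations`), or from
an immersion that is relatively open onto `S` (`hasSliceChartAt_of_parametrization`). Everything is
done in the analytic category: analyticity at a point spreads to a neighbourhood, whereas `C^∞`
smoothness at a point in Mathlib's sense does not.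

*The orthogonal group.* Near `U ∈ O(C)` the coordinates of `X` are the entries above the diagonal of
`Uᵀ X`, and the equations are the entries of `Xᵀ X - 1` on and below it. This gives the dimension
`C (C - 1) / 2`.

*The generic stratum.* Write `F` for `sharedBasisOperator`. Composing a local parametrization of
`O(C)` with `F` gives a map from `ℝ^{C (C - 1) / 2} × ℝ^{K × C}`. Two things have to be checked.

* The derivative is injective (`eq_zero_of_tangent_eq_zero`). In the basis `U`, the image of a
  tangent vector is `A Λ(k) - Λ(k) A + N(k)` with `A` skew-symmetric and `N(k)` diagonal. If it
  vanishes, its diagonal gives `N = 0`, its entry `(i, j)` gives `A_ij (λ_kj - λ_ki) = 0` for all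
  `k`, and `s_i ≠ s_j` gives `A_ij = 0`.
* `F` is open onto the stratum (`eventually_exists_mem_nhds_eq_sharedBasisOperator`), although it is
  not injective. This uses compactness of `O(C)`: if `F(V, Λ)` is close to `F(U₀, Λ₀)`, then `V` is
  close to some `U` with `F(U, Λ') = F(U₀, Λ₀)`. For such `U` the matrix `Q = U₀ᵀ U` is a signed
  permutation, so `V Qᵀ` also diagonalizes `F(V, Λ)`, and `V Qᵀ` is close to `U₀`.

A parametrization with injective derivative has an analytic local left inverse, so `F` has one too,
and an open map with smooth local left inverses is a local diffeomorphism
(`isLocalDiffeomorph_of_isOpenMap_of_leftInverse`).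
-/

open Topology Module

/-! ### Slice charts and the inverse function theorem -/

section Slices

variable {E G : Type} [NormedAddCommGroup E] [NormedSpace ℝ E] [FiniteDimensional ℝ E]
  [NormedAddCommGroup G] [NormedSpace ℝ G] [FiniteDimensional ℝ G]

/-- Inverse function theorem: in equal finite dimensions, an analytic map with injective derivative
at `x` restricts to an analytic chart around `x`. -/
theorem exists_openPartialHomeomorph_of_fderiv_injective {f : E → G} {x : E}
    (hf : ContDiffAt ℝ ω f x) (hinj : ∀ v, fderiv ℝ f x v = 0 → v = 0)
    (hdim : finrank ℝ E = finrank ℝ G) :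
    ∃ φ : OpenPartialHomeomorph E G, x ∈ φ.source ∧ (∀ y, φ y = f y) ∧
      ContDiffOn ℝ ω φ φ.source ∧ ContDiffOn ℝ ω φ.symm φ.target := by
  have := FiniteDimensional.complete ℝ E
  have hinj' : Function.Injective (fderiv ℝ f x : E →ₗ[ℝ] G) :=
    (injective_iff_map_eq_zero _).2 hinj
  let e : E ≃L[ℝ] G :=
    (LinearEquiv.ofInjectiveOfFinrankEq _ hinj' hdim).toContinuousLinearEquiv
  have he : HasFDerivAt f (e : E →L[ℝ] G) x := by
    convert (hf.differentiableAt (by simp)).hasFDerivAt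
    ext v
    rfl
  have hω : (ω : WithTop ℕ∞) ≠ 0 := by simp
  have hω' : (ω : WithTop ℕ∞) ≠ ∞ := by simp
  let φ := hf.toOpenPartialHomeomorph f he hω
  refine ⟨φ.restrContDiff ℝ ω hω', ?_, fun y => rfl,
    φ.contDiffOn_restrContDiff_source ℝ hω', φ.contDiffOn_restrContDiff_target ℝ hω'⟩
  have hx : x ∈ φ.source := hf.mem_toOpenPartialHomeomorph_source he hω
  have hsymm : ContDiffAt ℝ ω φ.symm (φ x) := by
    refine φ.contDiffAt_symm (f₀' := e) (φ.map_source hx) ?_ ?_ <;> rw [φ.left_inv hx]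
    exacts [he, hf]
  exact ⟨hx, hf, hsymm⟩

/-- `IsSliceChart S φ`: the real-analytic chart `φ` of the ambient space straightens `S`, that is,
in its domain `S` is the zero set of the second coordinate. -/
structure IsSliceChart {E₀ F : Type} [NormedAddCommGroup E₀] [NormedSpace ℝ E₀]
    [NormedAddCommGroup F] [NormedSpace ℝ F]
    (S : Set E) (φ : OpenPartialHomeomorph E (E₀ × F)) : Prop where
  contDiffOn : ContDiffOn ℝ ω φ φ.source
  contDiffOn_symm : ContDiffOn ℝ ω φ.symm φ.target
  mem_iff : ∀ y ∈ φ.source, (y ∈ S ↔ (φ y).2 = 0)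

/-- `HasSliceChartAt S d x`: around `x`, some chart of the ambient space maps `S` to `ℝ^d × {0}`.
The codimension is a natural number subtraction, so `d ≤ finrank ℝ E` is part of the definition. -/
def HasSliceChartAt (S : Set E) (d : ℕ) (x : E) : Prop :=
  d ≤ finrank ℝ E ∧ ∃ φ : OpenPartialHomeomorph E
      (EuclideanSpace ℝ (Fin d) × EuclideanSpace ℝ (Fin (finrank ℝ E - d))),
    x ∈ φ.source ∧ IsSliceChart S φ

/-- `HasSliceCharts S d`: the set `S` has slice charts of dimension `d` around all its points. -/
def HasSliceCharts (S : Set E) (d : ℕ) : Prop :=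
  ∀ x ∈ S, HasSliceChartAt S d x

/-- A chart that straightens `S` near `x` becomes a slice chart after shrinking its domain. -/
theorem exists_isSliceChart_of_eventually {E E₀ F : Type} [NormedAddCommGroup E] [NormedSpace ℝ E]
    [NormedAddCommGroup E₀] [NormedSpace ℝ E₀]
    [NormedAddCommGroup F] [NormedSpace ℝ F] {S : Set E} {x : E}
    (φ : OpenPartialHomeomorph E (E₀ × F)) (hx : x ∈ φ.source)
    (h : ContDiffOn ℝ ω φ φ.source) (h' : ContDiffOn ℝ ω φ.symm φ.target)
    (hS : ∀ᶠ y in 𝓝 x, (y ∈ S ↔ (φ y).2 = 0)) :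
    ∃ φ : OpenPartialHomeomorph E (E₀ × F), x ∈ φ.source ∧ IsSliceChart S φ := by
  obtain ⟨W, hW, hWo, hxW⟩ := eventually_nhds_iff.1 hS
  refine ⟨φ.restrOpen W hWo, ⟨hx, hxW⟩, ⟨h.mono ?_, h'.mono ?_, fun y hy => hW y hy.2⟩⟩
  · exact fun y hy => hy.1
  · exact fun y hy => hy.1

/-- Slice charts from equations: near `x` the set `S` is the zero set of the second component of
`f`, and the first component completes it to a local coordinate system. -/
theorem hasSliceChartAt_of_equations {E₁ E₂ : Type}
    [NormedAddCommGroup E₁] [NormedSpace ℝ E₁] [FiniteDimensional ℝ E₁]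
    [NormedAddCommGroup E₂] [NormedSpace ℝ E₂] [FiniteDimensional ℝ E₂]
    {S : Set E} {x : E} {d : ℕ} {f : E → E₁ × E₂} (hf : ContDiffAt ℝ ω f x)
    (hinj : ∀ v, fderiv ℝ f x v = 0 → v = 0) (hd : finrank ℝ E₁ = d)
    (hdim : finrank ℝ E = finrank ℝ E₁ + finrank ℝ E₂)
    (hS : ∀ᶠ y in 𝓝 x, (y ∈ S ↔ (f y).2 = 0)) :
    HasSliceChartAt S d x := by
  let e₁ : E₁ ≃L[ℝ] EuclideanSpace ℝ (Fin d) := ContinuousLinearEquiv.ofFinrankEq (by simp [hd])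
  let e₂ : E₂ ≃L[ℝ] EuclideanSpace ℝ (Fin (finrank ℝ E - d)) :=
    ContinuousLinearEquiv.ofFinrankEq (by rw [finrank_euclideanSpace_fin]; omega)
  let e := e₁.prodCongr e₂
  have hder : ∀ v, fderiv ℝ (e ∘ f) x v = e (fderiv ℝ f x v) := fun v => by
    rw [e.comp_fderiv]; rfl
  obtain ⟨φ, hxφ, hφf, h, h'⟩ := exists_openPartialHomeomorph_of_fderiv_injective
    (f := e ∘ f) (x := x) (e.contDiff.contDiffAt.comp x hf)
    (fun v hv => hinj v (by simpa [hder] using hv)) (by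
      rw [← e.toLinearEquiv.finrank_eq, finrank_prod, hdim])
  refine ⟨by omega, ?_⟩
  refine exists_isSliceChart_of_eventually φ hxφ h h' (hS.mono fun y hy => ?_)
  rw [hy, hφf]
  exact (e₂.map_eq_zero_iff).symm

/-- Slice charts from a parametrization: `g` is an immersion at `u₀` with values in `S`, and it maps
neighbourhoods of `u₀` onto relative neighbourhoods of `g u₀` in `S`. The chart is the local inverse
of `(u, w) ↦ g u + w`, for `w` in a complement of the range of the derivative. -/
theorem hasSliceChartAt_of_parametrization {E₁ : Type}
    [NormedAddCommGroup E₁] [NormedSpace ℝ E₁] [FiniteDimensional ℝ E₁]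
    {S : Set E} {u₀ : E₁} {d : ℕ} {g : E₁ → E} (hg : ContDiffAt ℝ ω g u₀)
    (hinj : ∀ v, fderiv ℝ g u₀ v = 0 → v = 0) (hd : finrank ℝ E₁ = d)
    (hmem : ∀ᶠ u in 𝓝 u₀, g u ∈ S)
    (hopen : ∀ N ∈ 𝓝 u₀, ∀ᶠ y in 𝓝 (g u₀), y ∈ S → y ∈ g '' N) :
    HasSliceChartAt S d (g u₀) := by
  let L : E₁ →ₗ[ℝ] E := fderiv ℝ g u₀
  have hL : Function.Injective L := (injective_iff_map_eq_zero _).2 hinj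
  obtain ⟨W, hW⟩ := L.range.exists_isCompl
  have hrange : finrank ℝ L.range = d := by rw [LinearMap.finrank_range_of_inj hL, hd]
  have hsum := Submodule.finrank_add_eq_of_isCompl hW
  let e : EuclideanSpace ℝ (Fin d) ≃L[ℝ] E₁ := ContinuousLinearEquiv.ofFinrankEq (by simp [hd])
  let ι : EuclideanSpace ℝ (Fin (finrank ℝ E - d)) ≃L[ℝ] W :=
    ContinuousLinearEquiv.ofFinrankEq (by rw [finrank_euclideanSpace_fin]; omega)
  let ι' : EuclideanSpace ℝ (Fin (finrank ℝ E - d)) →L[ℝ] E :=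
    W.subtypeL.comp (ι : EuclideanSpace ℝ (Fin (finrank ℝ E - d)) →L[ℝ] W)
  let Ψ : EuclideanSpace ℝ (Fin d) × EuclideanSpace ℝ (Fin (finrank ℝ E - d)) → E :=
    fun p => g (e p.1) + ι' p.2
  let p₀ : EuclideanSpace ℝ (Fin d) × EuclideanSpace ℝ (Fin (finrank ℝ E - d)) := (e.symm u₀, 0)
  have he₀ : e p₀.1 = u₀ := e.apply_symm_apply u₀
  have hg' : ContDiffAt ℝ ω g (e p₀.1) := by rwa [he₀]
  have hΨ : ContDiffAt ℝ ω Ψ p₀ := by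
    refine ContDiffAt.add ?_ (ι'.contDiff.comp contDiff_snd).contDiffAt
    exact ContDiffAt.comp p₀ hg' (e.contDiff.comp contDiff_fst).contDiffAt
  have hder : ∀ v, fderiv ℝ Ψ p₀ v = L (e v.1) + ι' v.2 := by
    intro v
    have h1 : HasFDerivAt g (fderiv ℝ g u₀) (e p₀.1) := by
      rw [he₀]; exact (hg.differentiableAt (by simp)).hasFDerivAt
    have h2 : HasFDerivAt Ψ _ p₀ :=
      (h1.comp p₀ (e.hasFDerivAt.comp p₀ hasFDerivAt_fst)).add
        (ι'.hasFDerivAt.comp p₀ hasFDerivAt_snd)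
    rw [h2.fderiv]
    rfl
  obtain ⟨ψ, hp₀, hψ, h, h'⟩ := exists_openPartialHomeomorph_of_fderiv_injective hΨ
    (fun v hv => by
      rw [hder] at hv
      have hv1 : L (e v.1) ∈ W := by
        rw [eq_neg_of_add_eq_zero_left hv]
        exact W.neg_mem (ι v.2).2
      have h0 : L (e v.1) = 0 :=
        Submodule.disjoint_def.1 hW.disjoint _ (LinearMap.mem_range_self L _) hv1
      have hv2 : ι' v.2 = 0 := by simpa [h0] using hv
      have h3 : ι v.2 = 0 := Subtype.ext hv2
      refine Prod.ext ?_ ?_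
      · exact e.map_eq_zero_iff.1 ((map_eq_zero_iff L hL).1 h0)
      · exact ι.map_eq_zero_iff.1 h3)
    (by simp only [finrank_prod, finrank_euclideanSpace_fin]; omega)
  have hΨ₀ : ψ p₀ = g u₀ := by
    rw [hψ]
    change g (e p₀.1) + ι' 0 = g u₀
    rw [he₀, map_zero, add_zero]
  have hΨ1 : ∀ a, Ψ (a, 0) = g (e a) := fun a => by simp [Ψ]
  have hx : g u₀ ∈ ψ.symm.source := hΨ₀ ▸ ψ.map_source hp₀
  refine ⟨by omega, ?_⟩
  refine exists_isSliceChart_of_eventually ψ.symm hx h' h ?_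
  -- Near `g u₀`, the points of `S` have preimages `u` under `g` with `(u, 0)` in the domain of `ψ`.
  have hN : {u | (e.symm u, (0 : EuclideanSpace ℝ (Fin (finrank ℝ E - d)))) ∈ ψ.source} ∈ 𝓝 u₀ := by
    have hc : Continuous fun u => (e.symm u, (0 : EuclideanSpace ℝ (Fin (finrank ℝ E - d)))) := by
      fun_prop
    exact hc.continuousAt.preimage_mem_nhds (ψ.open_source.mem_nhds hp₀)
  have hmem' : ∀ᶠ y in 𝓝 (g u₀), g (e (ψ.symm y).1) ∈ S := by
    have hc : ContinuousAt (fun y => e (ψ.symm y).1) (g u₀) :=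
      e.continuous.continuousAt.comp (continuousAt_fst.comp (ψ.symm.continuousAt hx))
    refine hc.eventually (p := fun u => g u ∈ S) ?_
    have hu₀ : e (ψ.symm (g u₀)).1 = u₀ := by rw [← hΨ₀, ψ.left_inv hp₀, he₀]
    change ∀ᶠ u in 𝓝 (e (ψ.symm (g u₀)).1), g u ∈ S
    rwa [hu₀]
  filter_upwards [hopen _ hN, hmem', ψ.symm.open_source.mem_nhds hx] with y hy hyS hyt
  constructor
  · intro hyS'
    obtain ⟨u, hu, rfl⟩ := hy hyS'
    have : ψ (e.symm u, 0) = g u := by rw [hψ, hΨ1, e.apply_symm_apply]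
    rw [← this, ψ.left_inv hu]
  · intro h0
    have h1 : (ψ.symm y) = ((ψ.symm y).1, 0) := Prod.ext rfl h0
    have h2 := ψ.right_inv hyt
    rw [hψ, h1, hΨ1] at h2
    rwa [h2] at hyS

end Slices

/-! ### The manifold structure given by slice charts -/

section SliceManifold

variable {E : Type} [NormedAddCommGroup E] [NormedSpace ℝ E]

theorem IsSliceChart.symm_mem {E₀ F : Type} [NormedAddCommGroup E₀] [NormedSpace ℝ E₀]
    [NormedAddCommGroup F] [NormedSpace ℝ F] {S : Set E} {φ : OpenPartialHomeomorph E (E₀ × F)}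
    (hφ : IsSliceChart S φ) {u : E₀} (hu : (u, 0) ∈ φ.target) : φ.symm (u, 0) ∈ S :=
  (hφ.mem_iff _ (φ.map_target hu)).2 (by rw [φ.right_inv hu])

theorem IsSliceChart.mk_fst_zero {E₀ F : Type} [NormedAddCommGroup E₀] [NormedSpace ℝ E₀]
    [NormedAddCommGroup F] [NormedSpace ℝ F] {S : Set E} {φ : OpenPartialHomeomorph E (E₀ × F)}
    (hφ : IsSliceChart S φ) {y : E} (hy : y ∈ φ.source) (hyS : y ∈ S) : ((φ y).1, 0) = φ y :=
  Prod.ext rfl ((hφ.mem_iff y hy).1 hyS).symm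

open Classical in
/-- The chart of `S` given by the first coordinate of a slice chart. The inverse takes
the value `x₀` where `φ.symm (u, 0)` is not in `S`, which does not happen on its target. -/
noncomputable def IsSliceChart.chart {E₀ F : Type} [NormedAddCommGroup E₀] [NormedSpace ℝ E₀]
    [NormedAddCommGroup F] [NormedSpace ℝ F] {S : Set E} {φ : OpenPartialHomeomorph E (E₀ × F)}
    (hφ : IsSliceChart S φ) (x₀ : S) : OpenPartialHomeomorph S E₀ where
  toFun y := (φ y).1
  invFun u := if h : φ.symm (u, 0) ∈ S then ⟨φ.symm (u, 0), h⟩ else x₀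
  source := {y | (y : E) ∈ φ.source}
  target := {u | (u, 0) ∈ φ.target}
  map_source' y hy := by
    have h := hφ.mk_fst_zero hy y.2
    change ((φ y).1, 0) ∈ φ.target
    rw [h]
    exact φ.map_source hy
  map_target' u hu := by
    have h := hφ.symm_mem hu
    simpa [h] using φ.map_target hu
  left_inv' y hy := by
    have h := hφ.mk_fst_zero hy y.2
    have h' : φ.symm ((φ y).1, 0) = y := by rw [h, φ.left_inv hy]
    simp [h']
  right_inv' u hu := by
    have h := hφ.symm_mem hu
    simp [h, φ.right_inv hu]
  open_source := φ.open_source.preimage continuous_subtype_val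
  open_target := φ.open_target.preimage (by fun_prop)
  continuousOn_toFun :=
    continuous_fst.comp_continuousOn
      (φ.continuousOn.comp continuous_subtype_val.continuousOn fun _ hy => hy)
  continuousOn_invFun := by
    rw [IsEmbedding.subtypeVal.isInducing.continuousOn_iff]
    have hc : ContinuousOn (fun u : E₀ => φ.symm (u, 0)) {u | (u, (0 : F)) ∈ φ.target} :=
      φ.symm.continuousOn.comp (by fun_prop) fun _ hu => hu
    refine hc.congr fun u hu => ?_
    have h := hφ.symm_mem hu
    simp [h]

section

variable {E₀ F : Type} [NormedAddCommGroup E₀] [NormedSpace ℝ E₀]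
    [NormedAddCommGroup F] [NormedSpace ℝ F] {S : Set E} {φ : OpenPartialHomeomorph E (E₀ × F)}

theorem IsSliceChart.coe_chart_symm (hφ : IsSliceChart S φ) (x₀ : S) {u : E₀}
    (hu : (u, 0) ∈ φ.target) : ((hφ.chart x₀).symm u : E) = φ.symm (u, 0) := by
  simp [IsSliceChart.chart, hφ.symm_mem hu]

end

variable {S : Set E} {d : ℕ}

/-- The smooth structure given by slice charts: its atlas consists of one chosen chart around each
point. -/
@[reducible] noncomputable def HasSliceCharts.chartedSpace (h : HasSliceCharts S d) :
    ChartedSpace (EuclideanSpace ℝ (Fin d)) S where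
  atlas := Set.range fun x : S => (h x x.2).2.choose_spec.2.chart x
  chartAt x := (h x x.2).2.choose_spec.2.chart x
  mem_chart_source x := (h x x.2).2.choose_spec.1
  chart_mem_atlas x := ⟨x, rfl⟩

theorem HasSliceCharts.isManifold (h : HasSliceCharts S d) :
    let := h.chartedSpace
    IsManifold (𝓡 d) ∞ S := by
  let := h.chartedSpace
  refine isManifold_of_contDiffOn _ _ _ ?_
  rintro _ _ ⟨x, rfl⟩ ⟨x', rfl⟩
  have hφ := (h x x.2).2.choose_spec.2
  have hφ' := (h x' x'.2).2.choose_spec.2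
  set φ := (h x x.2).2.choose
  set φ' := (h x' x'.2).2.choose
  have h1 : ContDiffOn ℝ ω (fun u : EuclideanSpace ℝ (Fin d) => (φ' (φ.symm (u, 0))).1)
      {u | (u, 0) ∈ φ.target ∧ φ.symm (u, 0) ∈ φ'.source} := by
    refine contDiff_fst.comp_contDiffOn (hφ'.contDiffOn.comp
      (hφ.contDiffOn_symm.comp (by fun_prop) fun u hu => hu.1) fun u hu => hu.2)
  refine ((h1.of_le le_top).congr_mono (fun u hu => ?_) fun u hu => ?_)
  · have hu' : (u, 0) ∈ φ.target := hu.1.1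
    change (φ' ((hφ.chart x).symm u)).1 = _
    rw [hφ.coe_chart_symm x hu']
  · have hu' : (u, 0) ∈ φ.target := hu.1.1
    have hu2 : ((hφ.chart x).symm u : E) ∈ φ'.source := hu.1.2
    rw [hφ.coe_chart_symm x hu'] at hu2
    exact ⟨hu', hu2⟩

theorem HasSliceCharts.isSmoothEmbedding [FiniteDimensional ℝ E] (h : HasSliceCharts S d) :
    let := h.chartedSpace
    Manifold.IsSmoothEmbedding (𝓡 d) 𝓘(ℝ, E) ∞ (Subtype.val : S → E) := by
  let := h.chartedSpace
  have := h.isManifold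
  refine ⟨Manifold.IsImmersionOfComplement.isImmersion
    (F := EuclideanSpace ℝ (Fin (finrank ℝ E - d))) fun x => ?_, IsEmbedding.subtypeVal⟩
  have hφ := (h x x.2).2.choose_spec.2
  have hx := (h x x.2).2.choose_spec.1
  set φ := (h x x.2).2.choose
  let e : (EuclideanSpace ℝ (Fin d) × EuclideanSpace ℝ (Fin (finrank ℝ E - d))) ≃L[ℝ] E :=
    ContinuousLinearEquiv.ofFinrankEq (by
      have := (h x x.2).1
      simp only [finrank_prod, finrank_euclideanSpace_fin]
      omega)
  refine Manifold.IsImmersionAtOfComplement.mk_of_continuousAt continuous_subtype_val.continuousAt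
    e (hφ.chart x) (φ.transHomeomorph e.toHomeomorph) hx hx
    (IsManifold.chart_mem_maximalAtlas (I := 𝓡 d) (n := ∞) x) ?_ ?_
  · refine OpenPartialHomeomorph.mem_maximalAtlas_of_contMDiffOn _ ?_ ?_
    · exact (e.contDiff.comp_contDiffOn (hφ.contDiffOn.of_le le_top)).contMDiffOn
    · exact (((hφ.contDiffOn_symm.of_le le_top).comp e.symm.contDiff.contDiffOn
        fun _ hy => hy)).contMDiffOn
  · intro u hu
    have hu' : (u, 0) ∈ φ.target := hu.2
    change e (φ ((hφ.chart x).symm u)) = e (u, 0)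
    rw [hφ.coe_chart_symm x hu', φ.right_inv hu']

end SliceManifold

/-! ### Local parametrizations and local diffeomorphisms -/

section LocalCharts

variable {E : Type} [NormedAddCommGroup E] [NormedSpace ℝ E]

/-- A slice chart gives a local parametrization `g` of `S` with an analytic left inverse `q` that is
defined on the ambient space. -/
theorem HasSliceChartAt.exists_parametrization {S : Set E} {d : ℕ} {x : E}
    (h : HasSliceChartAt S d x) (hx : x ∈ S) :
    ∃ (g : EuclideanSpace ℝ (Fin d) → E) (q : E → EuclideanSpace ℝ (Fin d)),
      ContDiffAt ℝ ω g (q x) ∧ ContDiffAt ℝ ω q x ∧ g (q x) = x ∧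
      (∀ᶠ u in 𝓝 (q x), g u ∈ S ∧ q (g u) = u) ∧ ∀ᶠ y in 𝓝 x, y ∈ S → g (q y) = y := by
  obtain ⟨-, φ, hxφ, hφ⟩ := h
  have hgq : ∀ y ∈ φ.source, y ∈ S → φ.symm ((φ y).1, 0) = y := fun y hy hyS => by
    rw [hφ.mk_fst_zero hy hyS, φ.left_inv hy]
  have ht : ((φ x).1, 0) ∈ φ.target := by
    rw [hφ.mk_fst_zero hxφ hx]
    exact φ.map_source hxφ
  refine ⟨fun u => φ.symm (u, 0), fun y => (φ y).1, ?_, ?_, hgq x hxφ hx, ?_, ?_⟩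
  · have h1 : ContDiffAt ℝ ω φ.symm ((φ x).1, 0) :=
      hφ.contDiffOn_symm.contDiffAt (φ.open_target.mem_nhds ht)
    exact h1.comp (f := fun u : EuclideanSpace ℝ (Fin d) => (u, (0 : EuclideanSpace ℝ _))) _
      (contDiff_id.prodMk contDiff_const).contDiffAt
  · exact (hφ.contDiffOn.contDiffAt (φ.open_source.mem_nhds hxφ)).fst
  · have hc : Continuous fun u : EuclideanSpace ℝ (Fin d) =>
      (u, (0 : EuclideanSpace ℝ (Fin (finrank ℝ E - d)))) := by fun_prop
    filter_upwards [hc.continuousAt.preimage_mem_nhds (φ.open_target.mem_nhds ht)] with u hu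
    exact ⟨hφ.symm_mem hu, by rw [φ.right_inv hu]⟩
  · exact Filter.eventually_of_mem (φ.open_source.mem_nhds hxφ) hgq

end LocalCharts

section LocalDiffeomorph

variable {E₁ E₂ E E' : Type} [NormedAddCommGroup E₁] [NormedSpace ℝ E₁]
  [NormedAddCommGroup E₂] [NormedSpace ℝ E₂]
  [NormedAddCommGroup E] [NormedSpace ℝ E]
  [NormedAddCommGroup E'] [NormedSpace ℝ E']
  {H₁ H₂ M N : Type} [TopologicalSpace H₁] [TopologicalSpace H₂]
  {I : ModelWithCorners ℝ E₁ H₁} {J : ModelWithCorners ℝ E₂ H₂}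
  [TopologicalSpace M] [ChartedSpace H₁ M] [TopologicalSpace N] [ChartedSpace H₂ N]

/-- Let `f : M → N` be an open map between manifolds embedded by `j` and `ι` in normed spaces. If
`f` is smooth and near each point has a left inverse that is induced by a smooth map of the ambient
spaces, then `f` is a local diffeomorphism. -/
theorem isLocalDiffeomorph_of_isOpenMap_of_leftInverse {f : M → N} {ι : N → E} {j : M → E'}
    (hι : Manifold.IsSmoothEmbedding J 𝓘(ℝ, E) ∞ ι)
    (hj : Manifold.IsSmoothEmbedding I 𝓘(ℝ, E') ∞ j)
    (hf : ContMDiff I 𝓘(ℝ, E) ∞ (ι ∘ f)) (hopen : IsOpenMap f)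
    (hinv : ∀ p, ∃ h : E → E', ContDiffAt ℝ ω h (ι (f p)) ∧ ∀ᶠ q in 𝓝 p, h (ι (f q)) = j q) :
    IsLocalDiffeomorph I J ∞ f := by
  intro p
  have hfc : Continuous f := hι.isEmbedding.continuous_iff.2 hf.continuous
  have hf' : ContMDiff I J ∞ f :=
    (ContMDiff.iff_comp_isImmersion hι.isImmersion).2 ⟨hfc, hf⟩
  obtain ⟨h, hh, hhj⟩ := hinv p
  have hh' : ∀ᶠ q in 𝓝 p, ContDiffAt ℝ ω h (ι (f q)) :=
    hf.continuous.continuousAt.eventually (hh.eventually (by simp))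
  obtain ⟨W, hW, hWo, hpW⟩ := eventually_nhds_iff.1 (hhj.and hh')
  have hinj : Set.InjOn f W := fun a ha b hb hab => hj.isEmbedding.injective <| by
    rw [← (hW a ha).1, ← (hW b hb).1, hab]
  have : Nonempty M := ⟨p⟩
  let e : OpenPartialHomeomorph M N := OpenPartialHomeomorph.ofContinuousOpen
    (hinj.toPartialEquiv f W) hfc.continuousOn hopen hWo
  have hcoe : ∀ q, e q = f q := fun q => rfl
  have hinv' : ContMDiffOn J I ∞ e.symm e.target := by
    intro y hy
    refine ContMDiffAt.contMDiffWithinAt ?_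
    have hyW : e.symm y ∈ W := e.map_target hy
    have hfy : f (e.symm y) = y := e.right_inv hy
    obtain ⟨F, _, _, hF⟩ := hj.isImmersion
    refine (ContMDiffAt.iff_comp_isImmersionAtOfComplement (hF (e.symm y))).2
      ⟨e.symm.continuousAt hy, ?_⟩
    have h1 : ContDiffAt ℝ ω h (ι y) := by
      rw [← hfy]
      exact (hW _ hyW).2
    have h2 : ContMDiffAt J 𝓘(ℝ, E') ∞ (h ∘ ι) y :=
      (h1.of_le le_top).contMDiffAt.comp y (hι.contMDiff y)
    refine h2.congr_of_eventuallyEq ?_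
    filter_upwards [e.open_target.mem_nhds hy] with z hz
    have hfz : f (e.symm z) = z := e.right_inv hz
    change j (e.symm z) = h (ι z)
    rw [← (hW _ (e.map_target hz)).1, hfz]
  exact ⟨{ toPartialEquiv := e.toPartialEquiv
           open_source := e.open_source
           open_target := e.open_target
           contMDiffOn_toFun := hf'.contMDiffOn
           contMDiffOn_invFun := hinv' }, hpW, fun _ _ => rfl⟩

end LocalDiffeomorph

/-! ### Derivatives along lines and local left inverses -/

section Line

variable {E G : Type} [NormedAddCommGroup E] [NormedSpace ℝ E]
  [NormedAddCommGroup G] [NormedSpace ℝ G]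

theorem HasFDerivAt.hasDerivAt_add_smul {f : E → G} {f' : E →L[ℝ] G} {x : E}
    (hf : HasFDerivAt f f' x) (v : E) : HasDerivAt (fun t : ℝ => f (x + t • v)) (f' v) 0 := by
  have h1 : HasDerivAt (fun t : ℝ => x + t • v) v 0 := by
    simpa using ((hasDerivAt_id (0 : ℝ)).smul_const v).const_add x
  have h2 : HasFDerivAt f f' (x + (0 : ℝ) • v) := by simpa using hf
  exact h2.comp_hasDerivAt (0 : ℝ) h1

theorem hasDerivAt_add_mul (a b : ℝ) : HasDerivAt (fun t : ℝ => a + t * b) b 0 := by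
  simpa using ((hasDerivAt_id (0 : ℝ)).mul_const b).const_add a

end Line

/-- An analytic map with injective derivative at `u₀` has an analytic left inverse near `u₀`. -/
theorem ContDiffAt.exists_leftInverse {E E₁ : Type} [NormedAddCommGroup E] [NormedSpace ℝ E]
    [FiniteDimensional ℝ E]
    [NormedAddCommGroup E₁] [NormedSpace ℝ E₁] [FiniteDimensional ℝ E₁] {g : E₁ → E} {u₀ : E₁}
    (hg : ContDiffAt ℝ ω g u₀) (hinj : ∀ v, fderiv ℝ g u₀ v = 0 → v = 0) :
    ∃ r : E → E₁, ContDiffAt ℝ ω r (g u₀) ∧ ∀ᶠ u in 𝓝 u₀, r (g u) = u := by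
  obtain ⟨π, hπ⟩ := (fderiv ℝ g u₀ : E₁ →ₗ[ℝ] E).exists_leftInverse_of_injective
    (LinearMap.ker_eq_bot'.2 hinj)
  let π' : E →L[ℝ] E₁ := π.toContinuousLinearMap
  have hπ' : ∀ v, π' (fderiv ℝ g u₀ v) = v := fun v => LinearMap.congr_fun hπ v
  obtain ⟨φ, h₀, hφ, -, h⟩ := exists_openPartialHomeomorph_of_fderiv_injective
    (f := π' ∘ g) (x := u₀) (π'.contDiff.contDiffAt.comp u₀ hg) (fun v hv => by
      have h1 := π'.hasFDerivAt.comp u₀ (hg.differentiableAt (by simp)).hasFDerivAt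
      rw [h1.fderiv] at hv
      rw [← hπ' v]
      exact hv) rfl
  refine ⟨fun y => φ.symm (π' y), ?_, ?_⟩
  · have ht : π' (g u₀) ∈ φ.target := by
      have := φ.map_source h₀
      rwa [hφ] at this
    exact (h.contDiffAt (φ.open_target.mem_nhds ht)).comp (g u₀) π'.contDiff.contDiffAt
  · filter_upwards [φ.open_source.mem_nhds h₀] with u hu
    have := φ.left_inv hu
    rwa [hφ] at this

/-! ### The orthogonal group -/

section OrthogonalGroup

theorem card_strictUpperIndex (C : ℕ) :
    Fintype.card {p : Fin C × Fin C // p.1 < p.2} = C * (C - 1) / 2 := by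
  rw [← Finset.sum_range_id, ← Fin.sum_univ_eq_sum_range (fun i => i) C, Fintype.card_subtype,
    Finset.card_filter, Fintype.sum_prod_type_right]
  refine Finset.sum_congr rfl fun j _ => ?_
  rw [← Finset.card_filter]
  rw [Finset.filter_gt_eq_Iio, Fin.card_Iio]

variable {C : ℕ}

theorem mem_orthogonalMatrices_iff {U : MatrixSpace C} :
    U ∈ orthogonalMatrices C ↔ (Matrix.of U).transpose * Matrix.of U = 1 :=
  Matrix.mem_orthogonalGroup_iff' _ _

theorem mul_transpose_of_mem_orthogonalMatrices {U : MatrixSpace C}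
    (hU : U ∈ orthogonalMatrices C) : Matrix.of U * (Matrix.of U).transpose = 1 :=
  (Matrix.mem_orthogonalGroup_iff _ _).1 hU

theorem mem_orthogonalMatrices_iff_forall {U : MatrixSpace C} :
    U ∈ orthogonalMatrices C ↔ ∀ i j, ∑ l, U l i * U l j = (1 : Matrix (Fin C) (Fin C) ℝ) i j := by
  rw [mem_orthogonalMatrices_iff, ← Matrix.ext_iff]
  rfl

theorem isCompact_orthogonalMatrices (C : ℕ) : IsCompact (orthogonalMatrices C) := by
  refine Metric.isCompact_of_isClosed_isBounded ?_ ?_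
  · have : orthogonalMatrices C = ⋂ i, ⋂ j,
        {U | ∑ l, U l i * U l j = (1 : Matrix (Fin C) (Fin C) ℝ) i j} := by
      ext U
      simp [mem_orthogonalMatrices_iff_forall]
    rw [this]
    exact isClosed_iInter fun i => isClosed_iInter fun j =>
      isClosed_eq (by fun_prop) continuous_const
  · refine isBounded_iff_forall_norm_le.2 ⟨1, fun U hU => ?_⟩
    refine (pi_norm_le_iff_of_nonneg zero_le_one).2 fun i =>
      (pi_norm_le_iff_of_nonneg zero_le_one).2 fun j => ?_
    exact entry_norm_bound_of_unitary (𝕜 := ℝ) hU i j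

theorem eq_zero_of_transpose_mul_eq_zero {U : MatrixSpace C} (hU : U ∈ orthogonalMatrices C)
    {V : MatrixSpace C} (h : ∀ i j, ∑ l, U l i * V l j = 0) : V = 0 := by
  have h0 : (Matrix.of U).transpose * Matrix.of V = 0 := by
    ext i j
    exact h i j
  have h1 : Matrix.of V = 0 := by
    rw [← Matrix.one_mul (Matrix.of V), ← mul_transpose_of_mem_orthogonalMatrices hU,
      Matrix.mul_assoc, h0, Matrix.mul_zero]
  exact h1

/-- Near `X = U`, the first component is a coordinate system on `O(C)`: the entries of `Uᵀ X` above
the diagonal. The second component is the defining equation `Xᵀ X = 1`, restricted to the entries on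
and below the diagonal, which suffice by symmetry. -/
def orthogonalEquations (U X : MatrixSpace C) :
    ({p : Fin C × Fin C // p.1 < p.2} → ℝ) × ({p : Fin C × Fin C // ¬ p.1 < p.2} → ℝ) :=
  (fun p => ∑ l, U l p.1.1 * X l p.1.2,
    fun p => ∑ l, X l p.1.1 * X l p.1.2 - (1 : Matrix (Fin C) (Fin C) ℝ) p.1.1 p.1.2)

theorem contDiff_orthogonalEquations (U : MatrixSpace C) :
    ContDiff ℝ ω (orthogonalEquations U) := by
  unfold orthogonalEquations
  fun_prop

theorem orthogonalEquations_snd_eq_zero_iff {U X : MatrixSpace C} :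
    (orthogonalEquations U X).2 = 0 ↔ X ∈ orthogonalMatrices C := by
  rw [mem_orthogonalMatrices_iff_forall]
  constructor
  · intro h
    have h' : ∀ i j, ¬ i < j → ∑ l, X l i * X l j = (1 : Matrix (Fin C) (Fin C) ℝ) i j :=
      fun i j hij => sub_eq_zero.1 (congrFun h ⟨(i, j), hij⟩)
    intro i j
    by_cases hij : i < j
    · rw [Matrix.one_apply_ne' hij.ne', ← Matrix.one_apply_ne hij.ne', ← h' j i hij.asymm]
      simp [mul_comm]
    · exact h' i j hij
  · intro h
    funext p
    exact sub_eq_zero.2 (h _ _)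

theorem hasSliceCharts_orthogonalMatrices (C : ℕ) :
    HasSliceCharts (orthogonalMatrices C) (C * (C - 1) / 2) := by
  intro U hU
  refine hasSliceChartAt_of_equations (contDiff_orthogonalEquations U).contDiffAt ?_
    (by rw [Module.finrank_fintype_fun_eq_card, card_strictUpperIndex]) ?_
    (Filter.Eventually.of_forall fun X => orthogonalEquations_snd_eq_zero_iff.symm)
  · intro V hV
    have hU' := (contDiff_orthogonalEquations U).differentiable (by simp) U
    have hd := hU'.hasFDerivAt.hasDerivAt_add_smul V
    rw [hV] at hd
    have h1 : ∀ i j, i < j → ∑ l, U l i * V l j = 0 := by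
      intro i j hij
      have hd1 := hasDerivAt_pi.1 hd.fst ⟨(i, j), hij⟩
      have hd2 : HasDerivAt (fun t : ℝ => ∑ l, U l i * (U l j + t * V l j))
          (∑ l, U l i * V l j) 0 := by
        refine HasDerivAt.fun_sum fun l _ => ?_
        exact (hasDerivAt_add_mul (U l j) (V l j)).const_mul (U l i)
      exact hd2.unique hd1
    have h2 : ∀ i j, ¬ i < j → ∑ l, (V l i * U l j + U l i * V l j) = 0 := by
      intro i j hij
      have hd1 := hasDerivAt_pi.1 hd.snd ⟨(i, j), hij⟩
      have hd2 : HasDerivAt (fun t : ℝ => ∑ l, (U l i + t * V l i) * (U l j + t * V l j)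
          - (1 : Matrix (Fin C) (Fin C) ℝ) i j) (∑ l, (V l i * U l j + U l i * V l j)) 0 := by
        refine HasDerivAt.sub_const _ (HasDerivAt.fun_sum fun l _ => ?_)
        simpa using
          (hasDerivAt_add_mul (U l i) (V l i)).fun_mul (hasDerivAt_add_mul (U l j) (V l j))
      exact hd2.unique hd1
    refine eq_zero_of_transpose_mul_eq_zero hU fun i j => ?_
    have h3 : ∀ i j, ∑ l, V l i * U l j = ∑ l, U l j * V l i := fun i j => by simp [mul_comm]
    by_cases hij : i < j
    · exact h1 i j hij
    · have h4 := h2 i j hij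
      rw [Finset.sum_add_distrib, h3] at h4
      rcases (not_lt.1 hij).eq_or_lt with rfl | hji
      · linarith
      · rw [h1 j i hji] at h4
        linarith
  · rw [Module.finrank_fintype_fun_eq_card, Module.finrank_fintype_fun_eq_card,
      ← Fintype.card_sum, Fintype.card_congr (Equiv.sumCompl _)]
    simp [Module.finrank_pi_fintype]

end OrthogonalGroup

/-! ### Openness of the parameterization onto the generic stratum -/

section GenericStratum

variable {K C : ℕ}

theorem sharedBasisOperator_apply (U : MatrixSpace C) (Λ : Fin K → Fin C → ℝ) (k : Fin K)
    (i j : Fin C) : sharedBasisOperator U Λ k i j = ∑ l, U i l * Λ k l * U j l := by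
  change (Matrix.of U * Matrix.diagonal (Λ k) * (Matrix.of U).transpose) i j = _
  rw [Matrix.mul_apply]
  simp only [Matrix.mul_diagonal, Matrix.transpose_apply, Matrix.of_apply]

theorem mem_genericStratum_iff {M : Fin K → MatrixSpace C} :
    M ∈ genericStratum K C ↔
      ∃ U ∈ orthogonalMatrices C, ∃ Λ ∈ genericGains K C, M = sharedBasisOperator U Λ :=
  ⟨fun h => h.2, fun ⟨U, hU, Λ, hΛ, h⟩ => ⟨⟨U, hU, Λ, hΛ.1, h⟩, U, hU, Λ, hΛ, h⟩⟩

theorem contDiff_sharedBasisOperator :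
    ContDiff ℝ ω fun p : MatrixSpace C × (Fin K → Fin C → ℝ) => sharedBasisOperator p.1 p.2 := by
  refine contDiff_pi.2 fun k => contDiff_pi.2 fun i => contDiff_pi.2 fun j => ?_
  simp only [sharedBasisOperator_apply]
  fun_prop

/-- The table of the diagonal entries of the matrices `Uᵀ M(k) U`. -/
def diagonalGains (U : MatrixSpace C) (M : Fin K → MatrixSpace C) : Fin K → Fin C → ℝ :=
  fun k i => ∑ a, ∑ b, U a i * M k a b * U b i

theorem diagonalGains_eq (U : MatrixSpace C) (M : Fin K → MatrixSpace C) (k : Fin K) :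
    diagonalGains U M k =
      Matrix.diag ((Matrix.of U).transpose * Matrix.of (M k) * Matrix.of U) := by
  funext i
  simp only [diagonalGains, Matrix.diag_apply, Matrix.mul_apply, Matrix.transpose_apply,
    Matrix.of_apply, Finset.sum_mul]
  exact Finset.sum_comm

/-- If the orthogonal matrix `U` diagonalizes all `M(k)`, the gains are the diagonal entries of
`Uᵀ M(k) U`. -/
theorem eq_sharedBasisOperator_diagonalGains {U : MatrixSpace C} (hU : U ∈ orthogonalMatrices C)
    {M : Fin K → MatrixSpace C} {Λ : Fin K → Fin C → ℝ}
    (h : ∀ k, (Matrix.of U).transpose * Matrix.of (M k) * Matrix.of U = Matrix.diagonal (Λ k)) :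
    M = sharedBasisOperator U (diagonalGains U M) := by
  have hU' : Matrix.of U * (Matrix.of U).transpose = 1 := mul_transpose_of_mem_orthogonalMatrices hU
  funext k
  have h1 : Matrix.of (M k) = Matrix.of U * Matrix.diagonal (Λ k) * (Matrix.of U).transpose := by
    rw [← h k]
    simp only [Matrix.mul_assoc, hU', Matrix.mul_one]
    rw [← Matrix.mul_assoc, hU', Matrix.one_mul]
  change M k = Matrix.of.symm (Matrix.of U * Matrix.diagonal _ * (Matrix.of U).transpose)
  rw [diagonalGains_eq, h k, Matrix.diag_diagonal, ← h1]
  rfl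

theorem transpose_mul_sharedBasisOperator_mul {U : MatrixSpace C} (hU : U ∈ orthogonalMatrices C)
    (Λ : Fin K → Fin C → ℝ) (k : Fin K) :
    (Matrix.of U).transpose * Matrix.of (sharedBasisOperator U Λ k) * Matrix.of U =
      Matrix.diagonal (Λ k) := by
  have hU' := mem_orthogonalMatrices_iff.1 hU
  change (Matrix.of U).transpose * (Matrix.of U * Matrix.diagonal (Λ k) * (Matrix.of U).transpose)
    * Matrix.of U = _
  simp only [Matrix.mul_assoc, hU', Matrix.mul_one]
  rw [← Matrix.mul_assoc, hU', Matrix.one_mul]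

theorem diagonalGains_sharedBasisOperator {U : MatrixSpace C} (hU : U ∈ orthogonalMatrices C)
    (Λ : Fin K → Fin C → ℝ) : diagonalGains U (sharedBasisOperator U Λ) = Λ := by
  funext k
  rw [diagonalGains_eq, transpose_mul_sharedBasisOperator_mul hU, Matrix.diag_diagonal]

/-- For two representations of the same tuple, the first of them generic, each column of `U₀ᵀ U` has
at most one nonzero entry: if the entry `(i, j)` is nonzero, the eigenmode `j` of the second
representation has the signature of the eigenmode `i` of the first, which determines `i`. -/
theorem intertwiner_apply_mul_eq_zero {U₀ U : MatrixSpace C} (hU₀ : U₀ ∈ orthogonalMatrices C)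
    (hU : U ∈ orthogonalMatrices C) {Λ₀ Λ : Fin K → Fin C → ℝ} (hΛ₀ : Λ₀ ∈ genericGains K C)
    (h : sharedBasisOperator U₀ Λ₀ = sharedBasisOperator U Λ) {i l : Fin C} (hil : i ≠ l)
    (j : Fin C) :
    ((Matrix.of U₀).transpose * Matrix.of U) i j * ((Matrix.of U₀).transpose * Matrix.of U) l j
      = 0 := by
  set Q := (Matrix.of U₀).transpose * Matrix.of U with hQ
  have hcomm : ∀ k, Matrix.diagonal (Λ₀ k) * Q = Q * Matrix.diagonal (Λ k) := by
    intro k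
    have h1 := transpose_mul_sharedBasisOperator_mul hU₀ Λ₀ k
    have h2 := transpose_mul_sharedBasisOperator_mul hU Λ k
    have hU₀' : Matrix.of U₀ * (Matrix.of U₀).transpose = 1 :=
      mul_transpose_of_mem_orthogonalMatrices hU₀
    have hU' : Matrix.of U * (Matrix.of U).transpose = 1 :=
      mul_transpose_of_mem_orthogonalMatrices hU
    rw [← h1, ← h2, h, hQ]
    calc _ = (Matrix.of U₀).transpose * Matrix.of (sharedBasisOperator U Λ k) *
          (Matrix.of U₀ * (Matrix.of U₀).transpose) * Matrix.of U := by
          simp only [Matrix.mul_assoc]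
      _ = (Matrix.of U₀).transpose * (Matrix.of U * (Matrix.of U).transpose) *
          Matrix.of (sharedBasisOperator U Λ k) * Matrix.of U := by
          rw [hU₀', hU', Matrix.mul_one, Matrix.mul_one]
      _ = _ := by simp only [Matrix.mul_assoc]
  have hentry : ∀ i, Q i j ≠ 0 → ∀ k, Λ₀ k i = Λ k j := by
    intro i hi k
    have := congrFun (congrFun (hcomm k) i) j
    rw [Matrix.diagonal_mul, Matrix.mul_diagonal, mul_comm] at this
    exact mul_left_cancel₀ hi this
  by_contra hne
  obtain ⟨h1, h2⟩ := mul_ne_zero_iff.1 hne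
  exact hΛ₀.2 i l hil (funext fun k => (hentry i h1 k).trans (hentry l h2 k).symm)

/-- Conjugation by a matrix with at most one nonzero entry in each column preserves diagonal
matrices. -/
theorem mul_diagonal_mul_transpose_eq_diagonal {Q : Matrix (Fin C) (Fin C) ℝ}
    (hQ : ∀ i l, i ≠ l → ∀ j, Q i j * Q l j = 0) (d : Fin C → ℝ) :
    Q * Matrix.diagonal d * Q.transpose =
      Matrix.diagonal (Matrix.diag (Q * Matrix.diagonal d * Q.transpose)) := by
  ext i l
  by_cases hil : i = l
  · subst hil
    simp
  · rw [Matrix.diagonal_apply_ne _ hil, Matrix.mul_apply]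
    refine Finset.sum_eq_zero fun j _ => ?_
    rw [Matrix.mul_diagonal, Matrix.transpose_apply, mul_right_comm, hQ i l hil, zero_mul]

/-- The shared-basis parameterization is open onto the generic stratum: members close to
`F(U₀, Λ₀)` have a representation close to `(U₀, Λ₀)`, even if they were given by another one. -/
theorem eventually_exists_mem_nhds_eq_sharedBasisOperator {U₀ : MatrixSpace C}
    (hU₀ : U₀ ∈ orthogonalMatrices C) {Λ₀ : Fin K → Fin C → ℝ} (hΛ₀ : Λ₀ ∈ genericGains K C)
    {N : Set (MatrixSpace C × (Fin K → Fin C → ℝ))} (hN : N ∈ 𝓝 (U₀, Λ₀)) :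
    ∀ᶠ M in 𝓝 (sharedBasisOperator U₀ Λ₀), M ∈ genericStratum K C →
      ∃ U ∈ orthogonalMatrices C, ∃ Λ ∈ genericGains K C,
        (U, Λ) ∈ N ∧ M = sharedBasisOperator U Λ := by
  set M₀ := sharedBasisOperator U₀ Λ₀ with hM₀
  have hcontF : Continuous fun p : MatrixSpace C × (Fin K → Fin C → ℝ) =>
    sharedBasisOperator p.1 p.2 := contDiff_sharedBasisOperator.continuous
  -- By compactness, it suffices to treat representations with `V` near a fixed `U` in `O(C)`. The
  -- assumption `V ∈ O(C)` is repeated because a neighbourhood of `U` also has other matrices.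
  have key : ∀ᶠ M in 𝓝 M₀, ∀ V ∈ orthogonalMatrices C, V ∈ orthogonalMatrices C →
      ∀ Λ, M = sharedBasisOperator V Λ → ∃ U ∈ orthogonalMatrices C, ∃ Λ ∈ genericGains K C,
        (U, Λ) ∈ N ∧ M = sharedBasisOperator U Λ := by
    refine (isCompact_orthogonalMatrices C).eventually_forall_of_forall_eventually fun U hU => ?_
    have hcontD : Continuous fun z : (Fin K → MatrixSpace C) × MatrixSpace C =>
        diagonalGains z.2 z.1 := by
      unfold diagonalGains
      fun_prop
    by_cases hM : M₀ = sharedBasisOperator U (diagonalGains U M₀)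
    -- If `U` diagonalizes `M₀`, the change of basis `V ↦ V Qᵀ` moves `U` to `U₀`.
    · obtain ⟨Q, hQ⟩ : ∃ Q, Q = (Matrix.of U₀).transpose * Matrix.of U := ⟨_, rfl⟩
      have hQ0 : ∀ i l, i ≠ l → ∀ j, Q i j * Q l j = 0 := by
        rw [hQ]
        exact fun i l hil j => intertwiner_apply_mul_eq_zero hU₀ hU hΛ₀ hM hil j
      have hQQ : Q.transpose * Q = 1 := by
        rw [hQ, Matrix.transpose_mul, Matrix.transpose_transpose, Matrix.mul_assoc,
          ← Matrix.mul_assoc (Matrix.of U₀), mul_transpose_of_mem_orthogonalMatrices hU₀,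
          Matrix.one_mul, mem_orthogonalMatrices_iff.1 hU]
      have hQQ' : Q * Q.transpose = 1 := mul_eq_one_comm.1 hQQ
      let R : MatrixSpace C → MatrixSpace C := fun V => Matrix.of.symm (Matrix.of V * Q.transpose)
      have hRU : R U = U₀ := by
        change Matrix.of.symm (Matrix.of U * Q.transpose) = U₀
        rw [hQ, Matrix.transpose_mul, Matrix.transpose_transpose, ← Matrix.mul_assoc,
          mul_transpose_of_mem_orthogonalMatrices hU, Matrix.one_mul]
        rfl
      have hRcont : Continuous R := by
        have : R = fun V i j => ∑ l, V i l * Q j l := by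
          funext V i j
          rfl
        rw [this]
        fun_prop
      have hc : Continuous fun z : (Fin K → MatrixSpace C) × MatrixSpace C =>
          (R z.2, diagonalGains (R z.2) z.1) :=
        (hRcont.comp continuous_snd).prodMk
          (hcontD.comp (continuous_fst.prodMk (hRcont.comp continuous_snd)))
      have hlim : (R U, diagonalGains (R U) M₀) = (U₀, Λ₀) := by
        rw [hRU, hM₀, diagonalGains_sharedBasisOperator hU₀]
      have hN' : N ∩ {p | p.2 ∈ genericGains K C} ∈ 𝓝 (R U, diagonalGains (R U) M₀) := by
        rw [hlim]
        exact Filter.inter_mem hN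
          (((genericGains K C).isOpen.preimage continuous_snd).mem_nhds hΛ₀)
      filter_upwards [hc.continuousAt.preimage_mem_nhds hN'] with z hz hV Λ hz1
      have hRV : Matrix.of (R z.2) = Matrix.of z.2 * Q.transpose := rfl
      have hVO := mem_orthogonalMatrices_iff.1 hV
      have hRVO : R z.2 ∈ orthogonalMatrices C := by
        rw [mem_orthogonalMatrices_iff, hRV, Matrix.transpose_mul, Matrix.transpose_transpose,
          Matrix.mul_assoc, ← Matrix.mul_assoc _ (Matrix.of z.2), hVO, Matrix.one_mul, hQQ']
      refine ⟨R z.2, hRVO, _, hz.2, hz.1, eq_sharedBasisOperator_diagonalGains hRVO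
        (Λ := fun k => Matrix.diag (Q * Matrix.diagonal (Λ k) * Q.transpose)) fun k => ?_⟩
      rw [← mul_diagonal_mul_transpose_eq_diagonal hQ0 (Λ k),
        ← transpose_mul_sharedBasisOperator_mul hV Λ k, hRV, Matrix.transpose_mul,
        Matrix.transpose_transpose, ← hz1]
      simp only [Matrix.mul_assoc]
    -- Otherwise no orthogonal `V` near `U` diagonalizes a tuple near `M₀`.
    · have hne : ∀ᶠ z : (Fin K → MatrixSpace C) × MatrixSpace C in 𝓝 (M₀, U),
          z.1 ≠ sharedBasisOperator z.2 (diagonalGains z.2 z.1) :=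
        (isOpen_ne_fun continuous_fst
          (hcontF.comp (continuous_snd.prodMk hcontD))).mem_nhds hM
      filter_upwards [hne] with z hz hV Λ hz1
      exact (hz (eq_sharedBasisOperator_diagonalGains hV fun k => by
        rw [hz1]; exact transpose_mul_sharedBasisOperator_mul hV Λ k)).elim
  filter_upwards [key] with M hM hMS
  obtain ⟨V, hV, Λ, -, hMV⟩ := mem_genericStratum_iff.1 hMS
  exact hM V hV hV Λ hMV

/-! ### The tangent map of the parameterization -/

/-- Injectivity of the derivative of `F` on the tangent space of `O(C) × 𝒢`: `hV` says that `V` is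
tangent to `O(C)` at `U`, and `h` that the derivative of `F` at `(U, Λ)` vanishes on `(V, N)`. -/
theorem eq_zero_of_tangent_eq_zero {U V : MatrixSpace C} {Λ N : Fin K → Fin C → ℝ}
    (hU : U ∈ orthogonalMatrices C) (hΛ : Λ ∈ genericGains K C)
    (hV : ∀ i j, ∑ l, (V l i * U l j + U l i * V l j) = 0)
    (h : ∀ k i j, ∑ l, ((V i l * Λ k l + U i l * N k l) * U j l + U i l * Λ k l * V j l) = 0) :
    V = 0 ∧ N = 0 := by
  let u : Matrix (Fin C) (Fin C) ℝ := Matrix.of U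
  let v : Matrix (Fin C) (Fin C) ℝ := Matrix.of V
  have hu : u.transpose * u = 1 := mem_orthogonalMatrices_iff.1 hU
  have hskew : v.transpose * u = -(u.transpose * v) := by
    refine eq_neg_of_add_eq_zero_left ?_
    ext i j
    have := hV i j
    rwa [Finset.sum_add_distrib] at this
  have hmat : ∀ k, (v * Matrix.diagonal (Λ k) + u * Matrix.diagonal (N k)) * u.transpose +
      u * Matrix.diagonal (Λ k) * v.transpose = 0 := by
    intro k
    ext i j
    have := h k i j
    rw [Finset.sum_add_distrib] at this
    rw [Matrix.add_apply, Matrix.mul_apply, Matrix.mul_apply]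
    simp only [Matrix.add_apply, Matrix.mul_diagonal, Matrix.transpose_apply]
    exact this
  have hconj : ∀ k, u.transpose * v * Matrix.diagonal (Λ k) + Matrix.diagonal (N k) -
      Matrix.diagonal (Λ k) * (u.transpose * v) = 0 := by
    intro k
    calc _ = u.transpose * v * Matrix.diagonal (Λ k) * (u.transpose * u) +
          (u.transpose * u) * Matrix.diagonal (N k) * (u.transpose * u) +
          (u.transpose * u) * Matrix.diagonal (Λ k) * (v.transpose * u) := by
          rw [hu, hskew, Matrix.mul_one, Matrix.one_mul, Matrix.mul_one, Matrix.one_mul,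
            Matrix.mul_neg, sub_eq_add_neg]
      _ = u.transpose * ((v * Matrix.diagonal (Λ k) + u * Matrix.diagonal (N k)) * u.transpose +
          u * Matrix.diagonal (Λ k) * v.transpose) * u := by
          simp only [Matrix.mul_add, Matrix.add_mul, Matrix.mul_assoc]
      _ = 0 := by rw [hmat, Matrix.mul_zero, Matrix.zero_mul]
  have hentry : ∀ k i j, (u.transpose * v) i j * Λ k j + Matrix.diagonal (N k) i j -
      Λ k i * (u.transpose * v) i j = 0 := by
    intro k i j
    have := congrFun (congrFun (hconj k) i) j
    rwa [Matrix.sub_apply, Matrix.add_apply, Matrix.mul_diagonal, Matrix.diagonal_mul] at this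
  constructor
  · refine eq_zero_of_transpose_mul_eq_zero hU fun i j => ?_
    change (u.transpose * v) i j = 0
    by_cases hij : i = j
    · subst hij
      have h1 : (v.transpose * u) i i = -(u.transpose * v) i i := by rw [hskew]; rfl
      have h2 : (v.transpose * u) i i = (u.transpose * v) i i := by
        simp [Matrix.mul_apply, mul_comm]
      linarith
    · obtain ⟨k, hk⟩ := Function.ne_iff.1 (hΛ.2 i j hij)
      have h1 := hentry k i j
      rw [Matrix.diagonal_apply_ne _ hij] at h1
      have h2 : (u.transpose * v) i j * (Λ k j - Λ k i) = 0 := by linarith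
      exact (mul_eq_zero.1 h2).resolve_right (sub_ne_zero.2 (Ne.symm hk))
  · funext k i
    have h1 := hentry k i i
    rw [Matrix.diagonal_apply_eq] at h1
    change N k i = 0
    linarith

/-- Composing an immersive local parametrization `g` of `O(C)` with `F` keeps the derivative
injective. -/
theorem fderiv_sharedBasisOperator_comp_injective {E₀ : Type} [NormedAddCommGroup E₀]
    [NormedSpace ℝ E₀] {g : E₀ → MatrixSpace C} {a : E₀} {Λ : Fin K → Fin C → ℝ}
    (hg : DifferentiableAt ℝ g a)
    (hdiff : DifferentiableAt ℝ
      (fun p : E₀ × (Fin K → Fin C → ℝ) => sharedBasisOperator (g p.1) p.2) (a, Λ))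
    (hginj : ∀ v, fderiv ℝ g a v = 0 → v = 0)
    (hgO : ∀ᶠ u in 𝓝 a, g u ∈ orthogonalMatrices C) (hΛ : Λ ∈ genericGains K C)
    (v : E₀ × (Fin K → Fin C → ℝ))
    (hv : fderiv ℝ (fun p : E₀ × (Fin K → Fin C → ℝ) => sharedBasisOperator (g p.1) p.2)
      (a, Λ) v = 0) : v = 0 := by
  have hX : HasDerivAt (fun t : ℝ => g (a + t • v.1)) (fderiv ℝ g a v.1) 0 :=
    hg.hasFDerivAt.hasDerivAt_add_smul v.1
  have hXe : ∀ i j, HasDerivAt (fun t : ℝ => g (a + t • v.1) i j) (fderiv ℝ g a v.1 i j) 0 :=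
    fun i j => hasDerivAt_pi.1 (hasDerivAt_pi.1 hX i) j
  have hM := hdiff.hasFDerivAt.hasDerivAt_add_smul v
  rw [hv] at hM
  have hO : ∀ᶠ t : ℝ in 𝓝 0, g (a + t • v.1) ∈ orthogonalMatrices C := by
    have hc : Filter.Tendsto (fun t : ℝ => a + t • v.1) (𝓝 0) (𝓝 a) := by
      simpa using ((continuous_id.smul continuous_const).const_add a).tendsto (0 : ℝ)
        (f := fun t : ℝ => a + t • v.1)
    exact hc.eventually hgO
  obtain ⟨h1, h2⟩ := eq_zero_of_tangent_eq_zero (U := g a) (V := fderiv ℝ g a v.1) (Λ := Λ)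
    (N := v.2) hgO.self_of_nhds hΛ (fun i j => by
      have hd : HasDerivAt (fun t : ℝ => ∑ l, g (a + t • v.1) l i * g (a + t • v.1) l j)
          (∑ l, (fderiv ℝ g a v.1 l i * g a l j + g a l i * fderiv ℝ g a v.1 l j)) 0 := by
        refine HasDerivAt.fun_sum fun l _ => ?_
        simpa using (hXe l i).fun_mul (hXe l j)
      refine (hd.congr_of_eventuallyEq ?_).unique
        (hasDerivAt_const (0 : ℝ) ((1 : Matrix (Fin C) (Fin C) ℝ) i j))
      filter_upwards [hO] with t ht
      exact (mem_orthogonalMatrices_iff_forall.1 ht i j).symm) (fun k i j => by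
      have hd : HasDerivAt (fun t : ℝ => ∑ l, g (a + t • v.1) i l * (Λ k l + t * v.2 k l) *
          g (a + t • v.1) j l) (∑ l, ((fderiv ℝ g a v.1 i l * Λ k l + g a i l * v.2 k l) * g a j l +
            g a i l * Λ k l * fderiv ℝ g a v.1 j l)) 0 := by
        refine HasDerivAt.fun_sum fun l _ => ?_
        simpa using ((hXe i l).fun_mul (hasDerivAt_add_mul (Λ k l) (v.2 k l))).fun_mul (hXe j l)
      refine hd.unique ?_
      have hMe := hasDerivAt_pi.1 (hasDerivAt_pi.1 (hasDerivAt_pi.1 hM k) i) j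
      simp only [sharedBasisOperator_apply] at hMe
      exact hMe)
  exact Prod.ext (hginj _ h1) h2

/-! ### The generic stratum as a submanifold -/

/-- Analytic coordinates `(q U, Λ)` near a point of `O(C) × 𝒢`: `g` is a local parametrization of
`O(C)` with left inverse `q`, and in these coordinates the shared-basis parameterization has
injective derivative. -/
theorem exists_parametrization_genericStratum {U₀ : MatrixSpace C}
    (hU₀ : U₀ ∈ orthogonalMatrices C) {Λ₀ : Fin K → Fin C → ℝ} (hΛ₀ : Λ₀ ∈ genericGains K C) :
    ∃ (g : EuclideanSpace ℝ (Fin (C * (C - 1) / 2)) → MatrixSpace C)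
      (q : MatrixSpace C → EuclideanSpace ℝ (Fin (C * (C - 1) / 2))),
      ContDiffAt ℝ ω g (q U₀) ∧ ContinuousAt q U₀ ∧ g (q U₀) = U₀ ∧
      (∀ᶠ u in 𝓝 (q U₀), g u ∈ orthogonalMatrices C) ∧
      (∀ᶠ U in 𝓝 U₀, U ∈ orthogonalMatrices C → g (q U) = U) ∧
      ContDiffAt ℝ ω (fun p : EuclideanSpace ℝ (Fin (C * (C - 1) / 2)) × (Fin K → Fin C → ℝ) =>
        sharedBasisOperator (g p.1) p.2) (q U₀, Λ₀) ∧
      ∀ v, fderiv ℝ (fun p : EuclideanSpace ℝ (Fin (C * (C - 1) / 2)) × (Fin K → Fin C → ℝ) =>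
        sharedBasisOperator (g p.1) p.2) (q U₀, Λ₀) v = 0 → v = 0 := by
  obtain ⟨g, q, hg, hq, hgq, hqg, hgO⟩ :=
    (hasSliceCharts_orthogonalMatrices C U₀ hU₀).exists_parametrization hU₀
  have hG : ContDiffAt ℝ ω (fun p : EuclideanSpace ℝ (Fin (C * (C - 1) / 2)) ×
      (Fin K → Fin C → ℝ) => sharedBasisOperator (g p.1) p.2) (q U₀, Λ₀) := by
    refine ContDiffAt.comp (q U₀, Λ₀)
      (g := fun p : MatrixSpace C × (Fin K → Fin C → ℝ) => sharedBasisOperator p.1 p.2)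
      (f := fun p : EuclideanSpace ℝ (Fin (C * (C - 1) / 2)) × (Fin K → Fin C → ℝ) => (g p.1, p.2))
      contDiff_sharedBasisOperator.contDiffAt ?_
    exact (ContDiffAt.comp (q U₀, Λ₀) (g := g) (f := Prod.fst) hg contDiffAt_fst).prodMk
      contDiffAt_snd
  refine ⟨g, q, hg, hq.continuousAt, hgq, hqg.mono fun u hu => hu.1, hgO, hG, fun v hv => ?_⟩
  refine fderiv_sharedBasisOperator_comp_injective (hg.differentiableAt (by simp))
    (hG.differentiableAt (by simp)) (fun w hw => ?_) (hqg.mono fun u hu => hu.1) hΛ₀ v hv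
  have hq' : HasFDerivAt q (fderiv ℝ q U₀) (g (q U₀)) := by
    rw [hgq]
    exact (hq.differentiableAt (by simp)).hasFDerivAt
  have h1 := (hq'.comp (q U₀) (hg.differentiableAt (by simp)).hasFDerivAt).congr_of_eventuallyEq
    (f₁ := id) (hqg.mono fun u hu => hu.2.symm)
  have h2 := h1.unique (hasFDerivAt_id (q U₀))
  have h3 := DFunLike.congr_fun h2 w
  simpa [hw] using h3.symm

theorem hasSliceCharts_genericStratum (K C : ℕ) :
    HasSliceCharts (genericStratum K C) (C * (C - 1) / 2 + K * C) := by
  intro M hM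
  obtain ⟨U₀, hU₀, Λ₀, hΛ₀, rfl⟩ := mem_genericStratum_iff.1 hM
  obtain ⟨g, q, hg, hq, hgq, hgO, hOg, hG, hGinj⟩ := exists_parametrization_genericStratum hU₀ hΛ₀
  have key := hasSliceChartAt_of_parametrization (S := genericStratum K C)
    (d := C * (C - 1) / 2 + K * C) hG hGinj (by simp [Module.finrank_pi_fintype]) ?_ ?_
  · simpa only [hgq] using key
  · have h1 : ∀ᶠ p in 𝓝 (q U₀, Λ₀), g p.1 ∈ orthogonalMatrices C :=
      (continuousAt_fst (p := (q U₀, Λ₀))).eventually hgO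
    have h2 : ∀ᶠ p in 𝓝 (q U₀, Λ₀), p.2 ∈ genericGains K C :=
      (continuousAt_snd (p := (q U₀, Λ₀))).eventually ((genericGains K C).isOpen.mem_nhds hΛ₀)
    filter_upwards [h1, h2] with p hp1 hp2
    exact mem_genericStratum_iff.2 ⟨_, hp1, _, hp2, rfl⟩
  · intro N hN
    have hc : ContinuousAt (fun p : MatrixSpace C × (Fin K → Fin C → ℝ) => (q p.1, p.2))
        (U₀, Λ₀) :=
      (ContinuousAt.comp (x := (U₀, Λ₀)) (g := q) (f := Prod.fst) hq continuousAt_fst).prodMk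
        continuousAt_snd
    have hN1 := hc.preimage_mem_nhds hN
    have hN2 : ∀ᶠ p : MatrixSpace C × (Fin K → Fin C → ℝ) in 𝓝 (U₀, Λ₀),
        p.1 ∈ orthogonalMatrices C → g (q p.1) = p.1 :=
      (continuousAt_fst (p := (U₀, Λ₀))).eventually hOg
    simp only [hgq]
    filter_upwards [eventually_exists_mem_nhds_eq_sharedBasisOperator hU₀ hΛ₀
      (Filter.inter_mem hN1 hN2)] with M hM hMS
    obtain ⟨U, hU, Λ, -, ⟨hUN, hUq⟩, rfl⟩ := hM hMS
    exact ⟨(q U, Λ), hUN, by simp only [hUq hU]⟩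

theorem isOpenMap_sharedBasisParam (K C : ℕ) : IsOpenMap (sharedBasisParam K C) := by
  rw [isOpenMap_iff_nhds_le]
  intro p s hs
  have hs' : sharedBasisParam K C ⁻¹' s ∈ 𝓝 p := hs
  have hj : IsInducing fun p : orthogonalMatrices C × genericGains K C =>
      ((p.1 : MatrixSpace C), (p.2 : Fin K → Fin C → ℝ)) :=
    IsInducing.subtypeVal.prodMap IsInducing.subtypeVal
  rw [hj.nhds_eq_comap] at hs'
  obtain ⟨t, ht, hts⟩ := hs'
  have h := eventually_exists_mem_nhds_eq_sharedBasisOperator p.1.2 p.2.2 ht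
  have h' : ∀ᶠ M : genericStratum K C in 𝓝 (sharedBasisParam K C p), _ :=
    (continuous_subtype_val (p := (· ∈ genericStratum K C))).continuousAt.eventually h
  filter_upwards [h'] with M hM
  obtain ⟨U, hU, Λ, hΛ, hUΛ, hMe⟩ := hM M.2
  have h1 : sharedBasisParam K C (⟨U, hU⟩, ⟨Λ, hΛ⟩) = M := Subtype.ext hMe.symm
  rw [← h1]
  exact hts (a := (⟨U, hU⟩, ⟨Λ, hΛ⟩)) hUΛ

theorem surjective_sharedBasisParam (K C : ℕ) : Function.Surjective (sharedBasisParam K C) := by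
  rintro ⟨M, hM⟩
  obtain ⟨U, hU, Λ, hΛ, h⟩ := mem_genericStratum_iff.1 hM
  exact ⟨(⟨U, hU⟩, ⟨Λ, hΛ⟩), Subtype.ext h.symm⟩

theorem genericStratum_nonempty (hK : 1 ≤ K) : (genericStratum K C).Nonempty := by
  refine ⟨_, mem_genericStratum_iff.2 ⟨Matrix.of.symm 1, ?_, fun _ j => (j : ℝ) + 1, ⟨?_, ?_⟩, rfl⟩⟩
  · exact one_mem (Matrix.orthogonalGroup (Fin C) ℝ)
  · exact fun _ j => by positivity
  · intro i j hij h
    have h1 := congrFun h ⟨0, hK⟩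
    simp only [jointSignature, add_left_inj, Nat.cast_inj] at h1
    exact hij (Fin.ext h1)

theorem isLocalDiffeomorph_sharedBasisParam (K C : ℕ) :
    letI := (hasSliceCharts_genericStratum K C).chartedSpace
    letI := (hasSliceCharts_orthogonalMatrices C).chartedSpace
    IsLocalDiffeomorph ((𝓡 (C * (C - 1) / 2)).prod 𝓘(ℝ, Fin K → Fin C → ℝ))
      (𝓡 (C * (C - 1) / 2 + K * C)) ∞ (sharedBasisParam K C) := by
  let := (hasSliceCharts_genericStratum K C).chartedSpace
  let := (hasSliceCharts_orthogonalMatrices C).chartedSpace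
  have := (hasSliceCharts_orthogonalMatrices C).isManifold
  have hj : Manifold.IsSmoothEmbedding ((𝓡 (C * (C - 1) / 2)).prod 𝓘(ℝ, Fin K → Fin C → ℝ))
      𝓘(ℝ, MatrixSpace C × (Fin K → Fin C → ℝ)) ∞
      fun p : orthogonalMatrices C × genericGains K C =>
        ((p.1 : MatrixSpace C), (p.2 : Fin K → Fin C → ℝ)) := by
    rw [modelWithCornersSelf_prod, ← chartedSpaceSelf_prod]
    exact (hasSliceCharts_orthogonalMatrices C).isSmoothEmbedding.prodMap
      (Manifold.IsSmoothEmbedding.of_opens (genericGains K C))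
  refine isLocalDiffeomorph_of_isOpenMap_of_leftInverse
    (hasSliceCharts_genericStratum K C).isSmoothEmbedding hj ?_ (isOpenMap_sharedBasisParam K C) ?_
  · have hF : ContMDiff 𝓘(ℝ, MatrixSpace C × (Fin K → Fin C → ℝ)) 𝓘(ℝ, Fin K → MatrixSpace C) ∞
        fun p : MatrixSpace C × (Fin K → Fin C → ℝ) => sharedBasisOperator p.1 p.2 :=
      ((contDiff_sharedBasisOperator (K := K) (C := C)).of_le le_top).contMDiff
    have hj' := hj.contMDiff
    have hFj := hF.comp hj'
    have he : (Subtype.val ∘ sharedBasisParam K C : _ → Fin K → MatrixSpace C) =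
      (fun p : MatrixSpace C × (Fin K → Fin C → ℝ) => sharedBasisOperator p.1 p.2) ∘
      (fun p : orthogonalMatrices C × genericGains K C =>
        ((p.1 : MatrixSpace C), (p.2 : Fin K → Fin C → ℝ))) := rfl
    rw [he]
    exact hFj
  · rintro ⟨⟨U₀, hU₀⟩, ⟨Λ₀, hΛ₀⟩⟩
    obtain ⟨g, q, hg, hq, hgq, hgO, hOg, hG, hGinj⟩ :=
      exists_parametrization_genericStratum hU₀ hΛ₀
    obtain ⟨r, hr, hrG⟩ := hG.exists_leftInverse hGinj
    simp only [hgq] at hr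
    have hr₀ : r (sharedBasisOperator U₀ Λ₀) = (q U₀, Λ₀) := by
      simpa only [hgq] using hrG.self_of_nhds
    -- `r` recovers the coordinates `(q U, Λ)` of `(U, Λ)`, and `g` recovers `U` from `q U`.
    refine ⟨fun M => (g (r M).1, (r M).2), ?_, ?_⟩
    · refine ContDiffAt.prodMk ?_ hr.snd
      refine ContDiffAt.comp (sharedBasisOperator U₀ Λ₀) (g := g) ?_ hr.fst
      rwa [hr₀]
    · have hc : ContinuousAt (fun p : MatrixSpace C × (Fin K → Fin C → ℝ) => (q p.1, p.2))
          (U₀, Λ₀) :=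
        (ContinuousAt.comp (x := (U₀, Λ₀)) (g := q) (f := Prod.fst) hq continuousAt_fst).prodMk
          continuousAt_snd
      have h1 := hc.eventually hrG
      have h2 : ∀ᶠ p : MatrixSpace C × (Fin K → Fin C → ℝ) in 𝓝 (U₀, Λ₀),
          p.1 ∈ orthogonalMatrices C → g (q p.1) = p.1 :=
      (continuousAt_fst (p := (U₀, Λ₀))).eventually hOg
      have hjc : ContinuousAt (fun p : orthogonalMatrices C × genericGains K C =>
        ((p.1 : MatrixSpace C), (p.2 : Fin K → Fin C → ℝ))) (⟨U₀, hU₀⟩, ⟨Λ₀, hΛ₀⟩) :=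
        hj.isEmbedding.continuous.continuousAt
      filter_upwards [hjc.eventually h1, hjc.eventually h2] with p hp1 hp2
      have hp := hp2 p.1.2
      simp only [hp] at hp1
      change (g (r (sharedBasisOperator p.1 p.2)).1, (r (sharedBasisOperator p.1 p.2)).2) = _
      rw [hp1]
      exact Prod.ext hp rfl

end GenericStratum

theorem proposition1 (K C : ℕ) :
    -- the generic stratum is not empty, so that its dimension is meaningful
    (1 ≤ K → (genericStratum K C).Nonempty) ∧
    ∃ (_ : ChartedSpace (EuclideanSpace ℝ (Fin (C * (C - 1) / 2 + K * C))) (genericStratum K C))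
      (_ : ChartedSpace (EuclideanSpace ℝ (Fin (C * (C - 1) / 2))) (orthogonalMatrices C)),
      -- the generic stratum is a smooth manifold of dimension `C(C-1)/2 + KC`
      IsEmbeddedSubmanifold (genericStratum K C) (C * (C - 1) / 2 + K * C) ∧
      -- the basis has `C(C-1)/2` degrees of freedom, the (open) gain table has `KC`
      IsEmbeddedSubmanifold (orthogonalMatrices C) (C * (C - 1) / 2) ∧
      Module.finrank ℝ (Fin K → Fin C → ℝ) = K * C ∧
      -- the parameterization matches the stratum locally
      Function.Surjective (sharedBasisParam K C) ∧
      IsLocalDiffeomorph ((𝓡 (C * (C - 1) / 2)).prod 𝓘(ℝ, Fin K → Fin C → ℝ))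
        (𝓡 (C * (C - 1) / 2 + K * C)) ∞ (sharedBasisParam K C) :=
  have hS := hasSliceCharts_genericStratum K C
  have hO := hasSliceCharts_orthogonalMatrices C
  ⟨genericStratum_nonempty, hS.chartedSpace, hO.chartedSpace,
    ⟨hS.isManifold, hS.isSmoothEmbedding⟩, ⟨hO.isManifold, hO.isSmoothEmbedding⟩,
    by simp [Module.finrank_pi_fintype], surjective_sharedBasisParam K C,
    isLocalDiffeomorph_sharedBasisParam K C⟩
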